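/- Let $K_A$ and $K_B$ be compact convex subsets of finite-dimensional real vector spaces. For such a set $K$ let $A(K)$ be the space of real affine functions on $K$, $A(K)^+$ the set of pointwise nonnegative ones, $1_K\in A(K)$ the constant function $1$, and identify $x\in K$ with the evaluation functional $f\mapsto f(x)$ in the dual space $A(K)^*$. Let $K^{\hat\otimes n}$ be the set of $\varphi\in (A(K)^*)^{\otimes n}$ with $\varphi(f_1\otimes\cdots\otimes f_n)\ge 0$ for all $f_1,\dots,f_n\in A(K)^+$ and $\varphi(1_K^{\otimes n})=1$. Let $K_A^{\hat\otimes n}\hat\otimes K_B^{\hat\otimes n}$ be the set of $\varphi\in (A(K_A)^*)^{\otimes n}\otimes (A(K_B)^*)^{\otimes n}$ with $\varphi(F\otimes G)\ge 0$ for all linear functionals $F$ on $(A(K_A)^*)^{\otimes n}$ and $G$ on $(A(K_B)^*)^{\otimes n}$ that are nonnegative on $K_A^{\hat\otimes n}$ and on $K_B^{\hat\otimes n}$ respectively, and $\varphi(1_{K_A}^{\otimes n}\otimes 1_{K_B}^{\otimes n})=1$. A sequence $(y_n)_{n\in\mathbb N}$ is called bicompatible if for every $n$: (i) $y_n\in K_A^{\hat\otimes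 n}\hat\otimes K_B^{\hat\otimes n}$; (ii) $y_n=(\mathrm{tr}_{A,n+1}\otimes \mathrm{tr}_{B,n+1})(y_{n+1})$, where $\mathrm{tr}_{A,n+1}$ is the linear map $v_1\otimes\cdots\otimes v_{n+1}\mapsto v_{n+1}(1_{K_A})\,v_1\otimes\cdots\otimes v_n$ on $(A(K_A)^*)^{\otimes (n+1)}$, and $\mathrm{tr}_{B,n+1}$ is defined likewise; (iii) $y_n=(S_{\sigma_A}\otimes S_{\sigma_B})(y_n)$ for all permutations $\sigma_A,\sigma_B$ of $\{1,\dots,n\}$, where $S_{\sigma_A}$, $S_{\sigma_B}$ are the linear maps that permute the $n$ tensor factors. Then for every bicompatible sequence $(y_n)_{n\in\mathbb N}$ there is a unique Borel probability measure $\mu$ on $K_A\times K_B$ such that for every $n\in\mathbb N$ \[ y_n=\int_{K_A\times K_B} x_A^{\otimes n}\otimes x_B^{\otimes n}\,d\mu(x_A,x_B). \] -/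

import Mathlib

open MeasureTheory
open scoped TensorProduct

noncomputable section

/-- `A(K)`: the real vector space of affine functions on a convex set `K`, that is, of functions
`K → ℝ` that respect all convex combinations of points of `K`. -/
def affFun {E : Type*} [AddCommGroup E] [Module ℝ E] (K : Set E) : Submodule ℝ (K → ℝ) where
  carrier := {f | ∀ (x y z : K) (a b : ℝ), 0 ≤ a → 0 ≤ b → a + b = 1 →
    (z : E) = a • (x : E) + b • (y : E) → f z = a * f x + b * f y}
  add_mem' := by
    intro f g hf hg x y z a b ha hb hab h
    simp only [Pi.add_apply, hf x y z a b ha hb hab h, hg x y z a b ha hb hab h]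
    ring
  zero_mem' := by
    intro x y z a b _ _ _ _
    simp
  smul_mem' := by
    intro c f hf x y z a b ha hb hab h
    simp only [Pi.smul_apply, smul_eq_mul, hf x y z a b ha hb hab h]
    ring

/-- The distinguished constant function `1_K ∈ A(K)`. -/
def unitFun {E : Type*} [AddCommGroup E] [Module ℝ E] (K : Set E) : affFun K :=
  ⟨fun _ => 1, by
    intro x y z a b _ _ hab _
    simp [hab]⟩

/-- `A(K)⁺`: the affine functions on `K` that are pointwise nonnegative. -/
def affPos {E : Type*} [AddCommGroup E] [Module ℝ E] (K : Set E) : Set (affFun K) :=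
  {f | ∀ x : K, 0 ≤ (f : K → ℝ) x}

/-- `A(K)^*`, the dual vector space of `A(K)`. -/
abbrev DualAff {E : Type*} [AddCommGroup E] [Module ℝ E] (K : Set E) : Type _ :=
  Module.Dual ℝ (affFun K)

/-- The embedding `K → A(K)^*`, `x ↦ φ_x`, with `φ_x(f) = f(x)`. -/
def stateEmb {E : Type*} [AddCommGroup E] [Module ℝ E] (K : Set E) (x : K) : DualAff K :=
  (LinearMap.proj x).comp (affFun K).subtype

/-- The `n`-fold tensor power `(A(K)^*)^{⊗ n}`. -/
abbrev DualAffPow {E : Type*} [AddCommGroup E] [Module ℝ E] (K : Set E) (n : ℕ) : Type _ :=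
  ⨂[ℝ] _ : Fin n, DualAff K

/-- For `f₁, …, fₙ ∈ A(K)`, the linear functional `f₁ ⊗ ⋯ ⊗ fₙ` on `(A(K)^*)^{⊗ n}`, given by
`v₁ ⊗ ⋯ ⊗ vₙ ↦ v₁(f₁) ⋯ vₙ(fₙ)`. -/
def prodFunctional {E : Type*} [AddCommGroup E] [Module ℝ E] (K : Set E) {n : ℕ}
    (f : Fin n → affFun K) : Module.Dual ℝ (DualAffPow K n) :=
  PiTensorProduct.lift
    ((MultilinearMap.mkPiAlgebra ℝ (Fin n) ℝ).compLinearMap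
      fun i => Module.Dual.eval ℝ (affFun K) (f i))

theorem prodFunctional_tprod {E : Type*} [AddCommGroup E] [Module ℝ E] (K : Set E) {n : ℕ}
    (f : Fin n → affFun K) (v : Fin n → DualAff K) :
    prodFunctional K f (PiTensorProduct.tprod ℝ v) = ∏ i, v i (f i) := by
  simp [prodFunctional]

/-- The functional `1_K ⊗ ⋯ ⊗ 1_K` (`n` factors), the unit of `K^{⊗̂ n}`. -/
def unitPow {E : Type*} [AddCommGroup E] [Module ℝ E] (K : Set E) (n : ℕ) :
    Module.Dual ℝ (DualAffPow K n) :=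
  prodFunctional K fun _ => unitFun K

/-- The `n`-fold maximal tensor power `K^{⊗̂ n}`: the elements of `(A(K)^*)^{⊗ n}` that are
nonnegative on `f₁ ⊗ ⋯ ⊗ fₙ` for all `f₁, …, fₙ ∈ A(K)⁺` and equal `1` on `1_K ⊗ ⋯ ⊗ 1_K`. -/
def maxTensorPow {E : Type*} [AddCommGroup E] [Module ℝ E] (K : Set E) (n : ℕ) :
    Set (DualAffPow K n) :=
  {φ | (∀ f : Fin n → affFun K, (∀ i, f i ∈ affPos K) → 0 ≤ prodFunctional K f φ) ∧
    unitPow K n φ = 1}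

/-- The maximal tensor product `S ⊗̂ T` of two state spaces that are given as sets
`S ⊆ V = A(S)^*` and `T ⊆ W = A(T)^*` with units `u ∈ V^* = A(S)` and `u' ∈ W^* = A(T)`:
the elements `φ` of `V ⊗ W` with `φ(F ⊗ G) ≥ 0` whenever `F ∈ A(S)⁺` and `G ∈ A(T)⁺`, that is,
whenever the linear functionals `F` and `G` are nonnegative on `S` and on `T`, and
`φ(u ⊗ u') = 1`. -/
def maxTensor {V W : Type*} [AddCommMonoid V] [Module ℝ V] [AddCommMonoid W] [Module ℝ W]
    (S : Set V) (u : Module.Dual ℝ V) (T : Set W) (u' : Module.Dual ℝ W) : Set (V ⊗[ℝ] W) :=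
  {φ | (∀ (F : Module.Dual ℝ V) (G : Module.Dual ℝ W), (∀ s ∈ S, 0 ≤ F s) → (∀ t ∈ T, 0 ≤ G t) →
      0 ≤ TensorProduct.dualDistrib ℝ V W (F ⊗ₜ[ℝ] G) φ) ∧
    TensorProduct.dualDistrib ℝ V W (u ⊗ₜ[ℝ] u') φ = 1}

/-- The partial trace over the last tensor factor,
`v₁ ⊗ ⋯ ⊗ vₙ₊₁ ↦ vₙ₊₁(1_K) • (v₁ ⊗ ⋯ ⊗ vₙ)`. -/
def partialTrace {E : Type*} [AddCommGroup E] [Module ℝ E] (K : Set E) (n : ℕ) :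
    DualAffPow K (n + 1) →ₗ[ℝ] DualAffPow K n :=
  PiTensorProduct.lift
    (MultilinearMap.uncurryRight
      ((LinearMap.smulRightₗ (Module.Dual.eval ℝ (affFun K) (unitFun K))).compMultilinearMap
        (PiTensorProduct.tprod ℝ (s := fun _ : Fin n => DualAff K))))

theorem partialTrace_tprod {E : Type*} [AddCommGroup E] [Module ℝ E] (K : Set E) (n : ℕ)
    (v : Fin (n + 1) → DualAff K) :
    partialTrace K n (PiTensorProduct.tprod ℝ v) =
      v (Fin.last n) (unitFun K) • PiTensorProduct.tprod ℝ (fun i : Fin n => v i.castSucc) := by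
  simp only [partialTrace, PiTensorProduct.lift.tprod]
  rfl

/-- The linear map `S_σ` that permutes the `n` tensor factors according to `σ`. -/
def permFactors {E : Type*} [AddCommGroup E] [Module ℝ E] (K : Set E) {n : ℕ}
    (σ : Equiv.Perm (Fin n)) : DualAffPow K n →ₗ[ℝ] DualAffPow K n :=
  (PiTensorProduct.reindex ℝ (fun _ : Fin n => DualAff K) σ).toLinearMap

/-- Bicompatible sequences: `yₙ ∈ K_A^{⊗̂ n} ⊗̂ K_B^{⊗̂ n}`, tracing out the last copies of
`K_A` and of `K_B` in `yₙ₊₁` gives `yₙ`, and `yₙ` is invariant under independent permutations of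
the copies of `K_A` and of the copies of `K_B`. (The term `y₀` is forced to be `1 ∈ ℝ ⊗ ℝ`.) -/
structure IsBicompatible {E F : Type*} [AddCommGroup E] [Module ℝ E] [AddCommGroup F] [Module ℝ F]
    (KA : Set E) (KB : Set F) (y : ∀ n : ℕ, DualAffPow KA n ⊗[ℝ] DualAffPow KB n) : Prop where
  mem : ∀ n, y n ∈ maxTensor (maxTensorPow KA n) (unitPow KA n) (maxTensorPow KB n) (unitPow KB n)
  trace : ∀ n, y n = TensorProduct.map (partialTrace KA n) (partialTrace KB n) (y (n + 1))
  symm : ∀ n (σA σB : Equiv.Perm (Fin n)),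
    y n = TensorProduct.map (permFactors KA σA) (permFactors KB σB) (y n)

/-- The tensor `x_A^{⊗ n} ⊗ x_B^{⊗ n}`. -/
def prodState {E F : Type*} [AddCommGroup E] [Module ℝ E] [AddCommGroup F] [Module ℝ F]
    (KA : Set E) (KB : Set F) (n : ℕ) (x : KA × KB) : DualAffPow KA n ⊗[ℝ] DualAffPow KB n :=
  PiTensorProduct.tprod ℝ (fun _ : Fin n => stateEmb KA x.1) ⊗ₜ[ℝ]
    PiTensorProduct.tprod ℝ (fun _ : Fin n => stateEmb KB x.2)

/-- `w = ∫ g dμ` for a function `g` with values in a finite-dimensional real vector space `W`: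
every linear functional (equivalently, every coordinate) of `g` is integrable, and its integral is
the value of that functional at `w`. -/
def IsVectorIntegral {X W : Type*} [MeasurableSpace X] [AddCommMonoid W] [Module ℝ W]
    (μ : Measure X) (g : X → W) (w : W) : Prop :=
  ∀ L : Module.Dual ℝ W, Integrable (fun x => L (g x)) μ ∧ L w = ∫ x, L (g x) ∂μ

end

/-! By symmetry, the pairing of `y n` with `f₁ ⊗ ⋯ ⊗ fₙ ⊗ g₁ ⊗ ⋯ ⊗ gₙ` depends only on the multiset
of the `fᵢ` and the multiset of the `gⱼ`; by the trace condition, adding a unit on both sides does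
not change it. The whole sequence is thus one functional `Λ` on monomials in `A(K_A)` and `A(K_B)`:
normalised, multilinear, and nonnegative on products of nonnegative functions
(`IsBicompatible.isMomentFunctional`).

Such functionals form a compact convex set. Multiplying by a positive factor and normalising stays
in this set, and `Λ` is a convex combination of the functionals obtained from `c·u + a` and `c·u -
a`; an extreme `Λ` is therefore multiplicative (`map_add_of_mem_extremePoints`), that is, a product
of two states. States on `A(K)` are points of `K` (`IsState.exists_eq_stateEmb`). By Krein–Milman,
`Λ` lies in every closed convex set that contains the products of point evaluations, and the moments
of probability measures form such a set (`IsMomentFunctional.exists_measure`).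

Uniqueness is of Stone–Weierstrass type: monomials span a point-separating algebra of continuous
functions (`measure_eq_of_integral_evalMoment_eq`). -/

noncomputable section

/-! ### Monomials in two families of variables. -/

section
variable {A B : Type*} {P : Set A} {Q : Set B}

/-- Monomials with positive factors. -/
def IsPositiveMonomial (P : Set A) (Q : Set B) (z : Multiset A × Multiset B) : Prop :=
  (∀ a ∈ z.1, a ∈ P) ∧ ∀ b ∈ z.2, b ∈ Q

theorem IsPositiveMonomial.add {z w : Multiset A × Multiset B} (hz : IsPositiveMonomial P Q z)
    (hw : IsPositiveMonomial P Q w) : IsPositiveMonomial P Q (z + w) := by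
  constructor
  · intro a ha
    rcases Multiset.mem_add.1 ha with ha | ha
    exacts [hz.1 a ha, hw.1 a ha]
  · intro b hb
    rcases Multiset.mem_add.1 hb with hb | hb
    exacts [hz.2 b hb, hw.2 b hb]

theorem isPositiveMonomial_left {a : A} (ha : a ∈ P) :
    IsPositiveMonomial P Q (({a}, 0) : Multiset A × Multiset B) :=
  ⟨by simpa using ha, by simp⟩

theorem isPositiveMonomial_right {b : B} (hb : b ∈ Q) :
    IsPositiveMonomial P Q ((0, {b}) : Multiset A × Multiset B) :=
  ⟨by simp, by simpa using hb⟩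

/-- Induction on monomials, one factor at a time. -/
theorem monomial_induction {p : Multiset A × Multiset B → Prop} (zero : p 0)
    (left : ∀ a z, p z → p (({a}, 0) + z)) (right : ∀ b z, p z → p ((0, {b}) + z))
    (z : Multiset A × Multiset B) : p z := by
  obtain ⟨s, t⟩ := z
  induction s using Multiset.induction_on with
  | empty =>
    induction t using Multiset.induction_on with
    | empty => exact zero
    | cons b t ih => simpa using right b _ ih
  | cons a s ih => simpa using left a _ ih

end

/-! ### Moment functionals: compactness and extreme points. -/

/-- A cone `P` in a real vector space for which `u` is an order unit. -/
structure IsOrderUnitCone {A : Type*} [AddCommGroup A] [Module ℝ A] (P : Set A) (u : A) :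
    Prop where
  add_mem : ∀ a a' : A, a ∈ P → a' ∈ P → a + a' ∈ P
  exists_bound : ∀ a : A, ∃ c : ℝ, 0 < c ∧ c • u + a ∈ P ∧ c • u - a ∈ P

/-- Moment functionals on the monomials in `A` and `B`: normalised, multilinear, compatible with
the units, and nonnegative on products of elements of the cones `P` and `Q`. -/
structure IsMomentFunctional {A B : Type*} [AddCommGroup A] [Module ℝ A] [AddCommGroup B]
    [Module ℝ B] (P : Set A) (u : A) (Q : Set B) (v : B) (Λ : Multiset A × Multiset B → ℝ) :
    Prop where
  map_zero : Λ 0 = 1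
  nonneg : ∀ z, IsPositiveMonomial P Q z → 0 ≤ Λ z
  add_left : ∀ a a' z, Λ (({a + a'}, 0) + z) = Λ (({a}, 0) + z) + Λ (({a'}, 0) + z)
  smul_left : ∀ (c : ℝ) a z, Λ (({c • a}, 0) + z) = c * Λ (({a}, 0) + z)
  unit_left : ∀ z, Λ (({u}, 0) + z) = Λ z
  add_right : ∀ b b' z, Λ ((0, {b + b'}) + z) = Λ ((0, {b}) + z) + Λ ((0, {b'}) + z)
  smul_right : ∀ (c : ℝ) b z, Λ ((0, {c • b}) + z) = c * Λ ((0, {b}) + z)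
  unit_right : ∀ z, Λ ((0, {v}) + z) = Λ z

/-- States of an ordered vector space with unit. -/
structure IsState {A : Type*} [AddCommGroup A] [Module ℝ A] (P : Set A) (u : A)
    (α : A →ₗ[ℝ] ℝ) : Prop where
  nonneg : ∀ a ∈ P, 0 ≤ α a
  unit : α u = 1

/-- The product of two linear functionals, as a functional on monomials. -/
def prodMoment {A B : Type*} [AddCommGroup A] [Module ℝ A] [AddCommGroup B] [Module ℝ B]
    (α : A →ₗ[ℝ] ℝ) (β : B →ₗ[ℝ] ℝ) (z : Multiset A × Multiset B) : ℝ :=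
  (z.1.map α).prod * (z.2.map β).prod

section
variable {A B : Type*} [AddCommGroup A] [Module ℝ A] [AddCommGroup B] [Module ℝ B]
  {P : Set A} {u : A} {Q : Set B} {v : B} {Λ : Multiset A × Multiset B → ℝ}

namespace IsMomentFunctional

theorem left_unit_add (h : IsMomentFunctional P u Q v Λ) (c : ℝ) (a : A)
    (z : Multiset A × Multiset B) :
    Λ (({c • u + a}, 0) + z) = c * Λ z + Λ (({a}, 0) + z) := by
  rw [h.add_left, h.smul_left, h.unit_left]

theorem left_unit_sub (h : IsMomentFunctional P u Q v Λ) (c : ℝ) (a : A)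
    (z : Multiset A × Multiset B) :
    Λ (({c • u - a}, 0) + z) = c * Λ z - Λ (({a}, 0) + z) := by
  rw [sub_eq_add_neg, ← neg_one_smul ℝ a, h.left_unit_add, h.smul_left]
  ring

theorem right_unit_add (h : IsMomentFunctional P u Q v Λ) (c : ℝ) (b : B)
    (z : Multiset A × Multiset B) :
    Λ ((0, {c • v + b}) + z) = c * Λ z + Λ ((0, {b}) + z) := by
  rw [h.add_right, h.smul_right, h.unit_right]

theorem right_unit_sub (h : IsMomentFunctional P u Q v Λ) (c : ℝ) (b : B)
    (z : Multiset A × Multiset B) :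
    Λ ((0, {c • v - b}) + z) = c * Λ z - Λ ((0, {b}) + z) := by
  rw [sub_eq_add_neg, ← neg_one_smul ℝ b, h.right_unit_add, h.smul_right]
  ring

/-- Multiplication by a positive monomial, followed by normalisation. -/
theorem shift (h : IsMomentFunctional P u Q v Λ) (m : Multiset A × Multiset B)
    (hm' : IsPositiveMonomial P Q m) (hm : 0 < Λ m) :
    IsMomentFunctional P u Q v fun z => Λ (m + z) / Λ m where
  map_zero := by simp [hm.ne']
  nonneg z hz := div_nonneg (h.nonneg _ (hm'.add hz)) hm.le
  add_left a a' z := by simp only [add_left_comm m, h.add_left, add_div]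
  smul_left c a z := by simp only [add_left_comm m, h.smul_left, mul_div_assoc]
  unit_left z := by simp only [add_left_comm m, h.unit_left]
  add_right b b' z := by simp only [add_left_comm m, h.add_right, add_div]
  smul_right c b z := by simp only [add_left_comm m, h.smul_right, mul_div_assoc]
  unit_right z := by simp only [add_left_comm m, h.unit_right]

end IsMomentFunctional

theorem convex_setOf_isMomentFunctional :
    Convex ℝ {Λ | IsMomentFunctional P u Q v Λ} := by
  intro Λ h Λ' h' s t hs ht hst
  exact
    { map_zero := by simp [h.map_zero, h'.map_zero, hst]
      nonneg := fun z hz => add_nonneg (mul_nonneg hs (h.nonneg z hz))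
        (mul_nonneg ht (h'.nonneg z hz))
      add_left := fun a a' z => by
        simp only [Pi.add_apply, Pi.smul_apply, smul_eq_mul, h.add_left, h'.add_left]; ring
      smul_left := fun c a z => by
        simp only [Pi.add_apply, Pi.smul_apply, smul_eq_mul, h.smul_left, h'.smul_left]; ring
      unit_left := fun z => by
        simp only [Pi.add_apply, Pi.smul_apply, smul_eq_mul, h.unit_left, h'.unit_left]
      add_right := fun a a' z => by
        simp only [Pi.add_apply, Pi.smul_apply, smul_eq_mul, h.add_right, h'.add_right]; ring
      smul_right := fun c a z => by
        simp only [Pi.add_apply, Pi.smul_apply, smul_eq_mul, h.smul_right, h'.smul_right]; ring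
      unit_right := fun z => by
        simp only [Pi.add_apply, Pi.smul_apply, smul_eq_mul, h.unit_right, h'.unit_right] }

theorem isClosed_setOf_isMomentFunctional :
    IsClosed {Λ | IsMomentFunctional P u Q v Λ} := by
  have key : {Λ | IsMomentFunctional P u Q v Λ} =
      {Λ : Multiset A × Multiset B → ℝ | Λ 0 = 1} ∩
      {Λ | ∀ z, IsPositiveMonomial P Q z → 0 ≤ Λ z} ∩
      {Λ | ∀ a a' z, Λ (({a + a'}, 0) + z) = Λ (({a}, 0) + z) + Λ (({a'}, 0) + z)} ∩
      {Λ | ∀ (c : ℝ) a z, Λ (({c • a}, 0) + z) = c * Λ (({a}, 0) + z)} ∩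
      {Λ | ∀ z, Λ (({u}, 0) + z) = Λ z} ∩
      {Λ | ∀ b b' z, Λ ((0, {b + b'}) + z) = Λ ((0, {b}) + z) + Λ ((0, {b'}) + z)} ∩
      {Λ | ∀ (c : ℝ) b z, Λ ((0, {c • b}) + z) = c * Λ ((0, {b}) + z)} ∩
      {Λ | ∀ z, Λ ((0, {v}) + z) = Λ z} := by
    ext Λ
    constructor
    · intro h
      exact ⟨⟨⟨⟨⟨⟨⟨h.1, h.2⟩, h.3⟩, h.4⟩, h.5⟩, h.6⟩, h.7⟩, h.8⟩
    · rintro ⟨⟨⟨⟨⟨⟨⟨h1, h2⟩, h3⟩, h4⟩, h5⟩, h6⟩, h7⟩, h8⟩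
      exact ⟨h1, h2, h3, h4, h5, h6, h7, h8⟩
  rw [key]
  simp only [Set.ofPred_forall]
  refine IsClosed.inter (IsClosed.inter (IsClosed.inter (IsClosed.inter (IsClosed.inter
    (IsClosed.inter (IsClosed.inter ?_ ?_) ?_) ?_) ?_) ?_) ?_) ?_
  · exact isClosed_eq (continuous_apply _) continuous_const
  · exact isClosed_iInter fun z => isClosed_iInter fun _ =>
      isClosed_le continuous_const (continuous_apply _)
  · exact isClosed_iInter fun a => isClosed_iInter fun a' => isClosed_iInter fun z =>
      isClosed_eq (by fun_prop) (by fun_prop)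
  · exact isClosed_iInter fun a => isClosed_iInter fun a' => isClosed_iInter fun z =>
      isClosed_eq (continuous_apply _) (continuous_const.mul (continuous_apply _))
  · exact isClosed_iInter fun z => isClosed_eq (continuous_apply _) (continuous_apply _)
  · exact isClosed_iInter fun a => isClosed_iInter fun a' => isClosed_iInter fun z =>
      isClosed_eq (by fun_prop) (by fun_prop)
  · exact isClosed_iInter fun a => isClosed_iInter fun a' => isClosed_iInter fun z =>
      isClosed_eq (continuous_apply _) (continuous_const.mul (continuous_apply _))
  · exact isClosed_iInter fun z => isClosed_eq (continuous_apply _) (continuous_apply _)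

/-- If `c·u - a` is in the cone, then `0 ≤ Λ(a z) ≤ c Λ(z)`, so each factor costs a constant
independent of `Λ`. -/
theorem exists_bound_of_isPositiveMonomial (hP : IsOrderUnitCone P u) (hQ : IsOrderUnitCone Q v)
    (z : Multiset A × Multiset B) (hz : IsPositiveMonomial P Q z) :
    ∃ r : ℝ, ∀ Λ, IsMomentFunctional P u Q v Λ → |Λ z| ≤ r := by
  induction z using monomial_induction with
  | zero => exact ⟨1, fun Λ h => by simp [h.map_zero]⟩
  | left a z ih =>
    have hz' : IsPositiveMonomial P Q z :=
      ⟨fun x hx => hz.1 x (by simp [hx]), fun x hx => hz.2 x (by simp [hx])⟩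
    obtain ⟨r, hr⟩ := ih hz'
    obtain ⟨c, hc, -, h2⟩ := hP.exists_bound a
    refine ⟨c * r, fun Λ h => ?_⟩
    rw [abs_of_nonneg (h.nonneg _ hz)]
    have h3 := ((isPositiveMonomial_left h2).add hz')
    have h4 := h.nonneg _ h3
    rw [h.left_unit_sub] at h4
    have h5 := mul_le_mul_of_nonneg_left ((le_abs_self _).trans (hr Λ h)) hc.le
    linarith
  | right b z ih =>
    have hz' : IsPositiveMonomial P Q z :=
      ⟨fun x hx => hz.1 x (by simp [hx]), fun x hx => hz.2 x (by simp [hx])⟩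
    obtain ⟨r, hr⟩ := ih hz'
    obtain ⟨c, hc, -, h2⟩ := hQ.exists_bound b
    refine ⟨c * r, fun Λ h => ?_⟩
    rw [abs_of_nonneg (h.nonneg _ hz)]
    have h3 := ((isPositiveMonomial_right h2).add hz')
    have h4 := h.nonneg _ h3
    rw [h.right_unit_sub] at h4
    have h5 := mul_le_mul_of_nonneg_left ((le_abs_self _).trans (hr Λ h)) hc.le
    linarith

/-- Each factor is written as `(c·u + a) - c·u`. The positive term `c·u + a` has to be kept while
the remaining factors are treated, hence the induction with an arbitrary positive monomial `p`
attached. -/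
theorem exists_bound_momentFunctional (hP : IsOrderUnitCone P u) (hQ : IsOrderUnitCone Q v)
    (z : Multiset A × Multiset B) :
    ∃ r : ℝ, ∀ Λ, IsMomentFunctional P u Q v Λ → |Λ z| ≤ r := by
  suffices H : ∀ p, IsPositiveMonomial P Q p →
      ∃ r : ℝ, ∀ Λ, IsMomentFunctional P u Q v Λ → |Λ (z + p)| ≤ r by
    simpa using H 0 ⟨by simp, by simp⟩
  induction z using monomial_induction with
  | zero => simpa using exists_bound_of_isPositiveMonomial hP hQ
  | left a z ih =>
    intro p hp
    obtain ⟨c, hc, h1, -⟩ := hP.exists_bound a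
    obtain ⟨r, hr⟩ := ih p hp
    obtain ⟨r', hr'⟩ := ih _ ((isPositiveMonomial_left h1).add hp)
    refine ⟨r' + c * r, fun Λ h => ?_⟩
    have h2 := hr' Λ h
    have h3 := mul_le_mul_of_nonneg_left (hr Λ h) hc.le
    rw [add_left_comm, h.left_unit_add] at h2
    have h4 : Λ (({a}, 0) + z + p) =
        (c * Λ (z + p) + Λ (({a}, 0) + (z + p))) - c * Λ (z + p) := by
      rw [add_assoc]; ring
    rw [h4]
    refine (abs_sub _ _).trans (add_le_add h2 ?_)
    rwa [abs_mul, abs_of_pos hc]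
  | right b z ih =>
    intro p hp
    obtain ⟨c, hc, h1, -⟩ := hQ.exists_bound b
    obtain ⟨r, hr⟩ := ih p hp
    obtain ⟨r', hr'⟩ := ih _ ((isPositiveMonomial_right h1).add hp)
    refine ⟨r' + c * r, fun Λ h => ?_⟩
    have h2 := hr' Λ h
    have h3 := mul_le_mul_of_nonneg_left (hr Λ h) hc.le
    rw [add_left_comm, h.right_unit_add] at h2
    have h4 : Λ ((0, {b}) + z + p) =
        (c * Λ (z + p) + Λ ((0, {b}) + (z + p))) - c * Λ (z + p) := by
      rw [add_assoc]; ring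
    rw [h4]
    refine (abs_sub _ _).trans (add_le_add h2 ?_)
    rwa [abs_mul, abs_of_pos hc]

theorem isCompact_setOf_isMomentFunctional (hP : IsOrderUnitCone P u)
    (hQ : IsOrderUnitCone Q v) : IsCompact {Λ | IsMomentFunctional P u Q v Λ} := by
  choose r hr using exists_bound_momentFunctional (P := P) (Q := Q) (u := u) (v := v) hP hQ
  refine (isCompact_univ_pi fun z => isCompact_Icc (a := -r z) (b := r z)).of_isClosed_subset
    isClosed_setOf_isMomentFunctional fun Λ h z _ => ?_
  exact abs_le.1 (hr z Λ h)

/-- By `hk`, `Λ` is the combination, with weights `Λ m / k` and `Λ m' / k`, of its normalised shifts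
by `m` and `m'`. Extremality makes the shift by `m` equal to `Λ`. -/
theorem map_add_of_mem_extremePoints
    (hΛ : Λ ∈ Set.extremePoints ℝ {Λ | IsMomentFunctional P u Q v Λ})
    {m m' : Multiset A × Multiset B} (hm : IsPositiveMonomial P Q m)
    (hm' : IsPositiveMonomial P Q m') (h0 : 0 < Λ m) (h0' : 0 < Λ m') {k : ℝ}
    (hk : ∀ z, Λ (m + z) + Λ (m' + z) = k * Λ z) (z : Multiset A × Multiset B) :
    Λ (m + z) = Λ m * Λ z := by
  have h : IsMomentFunctional P u Q v Λ := hΛ.1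
  have hk0 : Λ m + Λ m' = k := by simpa [h.map_zero] using hk 0
  have hkpos : 0 < k := by linarith
  have hseg : Λ ∈ openSegment ℝ (fun z => Λ (m + z) / Λ m) (fun z => Λ (m' + z) / Λ m') := by
    refine ⟨Λ m / k, Λ m' / k, div_pos h0 hkpos, div_pos h0' hkpos, ?_, ?_⟩
    · rw [← add_div, hk0, div_self hkpos.ne']
    · funext z
      simp only [Pi.add_apply, Pi.smul_apply, smul_eq_mul]
      have := hk z
      field_simp
      linarith
  have := congrFun (hΛ.2 (h.shift m hm h0) (h.shift m' hm' h0') hseg) z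
  field_simp at this
  linarith

/-- The factors `3c·u + a` and `3c·u - a` together multiply by `6c`, so extremality makes `Λ`
multiplicative in the first; the unit part then cancels. -/
theorem map_left_of_mem_extremePoints (hP : IsOrderUnitCone P u)
    (hΛ : Λ ∈ Set.extremePoints ℝ {Λ | IsMomentFunctional P u Q v Λ}) (a : A)
    (z : Multiset A × Multiset B) : Λ (({a}, 0) + z) = Λ ({a}, 0) * Λ z := by
  have h : IsMomentFunctional P u Q v Λ := hΛ.1
  obtain ⟨c, hc, h1, h2⟩ := hP.exists_bound a
  -- `P` is only known to be closed under sums, so `3c·u ± a` is built from `c·u + a` and `c·u - a`.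
  -- On these `Λ` is merely nonnegative; the extra `2c` makes the values positive, as normalisation
  -- requires.
  have h3 : (3 * c) • u + a ∈ P := by
    convert hP.add_mem _ _ (hP.add_mem _ _ h1 h2) h1 using 1; module
  have h4 : (3 * c) • u - a ∈ P := by
    convert hP.add_mem _ _ (hP.add_mem _ _ h1 h2) h2 using 1; module
  have e1 : ∀ z, Λ (({(3 * c) • u + a}, 0) + z) = _ := h.left_unit_add _ _
  have e2 : ∀ z, Λ (({(3 * c) • u - a}, 0) + z) = _ := h.left_unit_sub _ _
  have p1 := h.nonneg _ (isPositiveMonomial_left (Q := Q) h1)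
  have p2 := h.nonneg _ (isPositiveMonomial_left (Q := Q) h2)
  have f1 := h.left_unit_add c a 0
  have f2 := h.left_unit_sub c a 0
  have g1 := e1 0
  have g2 := e2 0
  simp only [add_zero, h.map_zero] at f1 f2 g1 g2
  have := map_add_of_mem_extremePoints hΛ (isPositiveMonomial_left h3)
    (isPositiveMonomial_left h4) (k := 6 * c) (by linarith) (by linarith)
    (fun z => by rw [e1, e2]; ring) z
  rw [e1, g1] at this
  linarith

theorem map_right_of_mem_extremePoints (hQ : IsOrderUnitCone Q v)
    (hΛ : Λ ∈ Set.extremePoints ℝ {Λ | IsMomentFunctional P u Q v Λ}) (b : B)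
    (z : Multiset A × Multiset B) : Λ ((0, {b}) + z) = Λ (0, {b}) * Λ z := by
  have h : IsMomentFunctional P u Q v Λ := hΛ.1
  obtain ⟨c, hc, h1, h2⟩ := hQ.exists_bound b
  have h3 : (3 * c) • v + b ∈ Q := by
    convert hQ.add_mem _ _ (hQ.add_mem _ _ h1 h2) h1 using 1; module
  have h4 : (3 * c) • v - b ∈ Q := by
    convert hQ.add_mem _ _ (hQ.add_mem _ _ h1 h2) h2 using 1; module
  have e1 : ∀ z, Λ ((0, {(3 * c) • v + b}) + z) = _ := h.right_unit_add _ _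
  have e2 : ∀ z, Λ ((0, {(3 * c) • v - b}) + z) = _ := h.right_unit_sub _ _
  have p1 := h.nonneg _ (isPositiveMonomial_right (P := P) h1)
  have p2 := h.nonneg _ (isPositiveMonomial_right (P := P) h2)
  have f1 := h.right_unit_add c b 0
  have f2 := h.right_unit_sub c b 0
  have g1 := e1 0
  have g2 := e2 0
  simp only [add_zero, h.map_zero] at f1 f2 g1 g2
  have := map_add_of_mem_extremePoints hΛ (isPositiveMonomial_right h3)
    (isPositiveMonomial_right h4) (k := 6 * c) (by linarith) (by linarith)
    (fun z => by rw [e1, e2]; ring) z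
  rw [e1, g1] at this
  linarith

/-- Extreme moment functionals are products of two states. -/
theorem exists_eq_prodMoment_of_mem_extremePoints (hP : IsOrderUnitCone P u)
    (hQ : IsOrderUnitCone Q v)
    (hΛ : Λ ∈ Set.extremePoints ℝ {Λ | IsMomentFunctional P u Q v Λ}) :
    ∃ (α : A →ₗ[ℝ] ℝ) (β : B →ₗ[ℝ] ℝ), IsState P u α ∧ IsState Q v β ∧ Λ = prodMoment α β := by
  have h : IsMomentFunctional P u Q v Λ := hΛ.1
  let α : A →ₗ[ℝ] ℝ :=
    { toFun := fun a => Λ ({a}, 0)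
      map_add' := fun a a' => by simpa using h.add_left a a' 0
      map_smul' := fun c a => by simpa using h.smul_left c a 0 }
  let β : B →ₗ[ℝ] ℝ :=
    { toFun := fun b => Λ (0, {b})
      map_add' := fun b b' => by simpa using h.add_right b b' 0
      map_smul' := fun c b => by simpa using h.smul_right c b 0 }
  refine ⟨α, β, ⟨fun a ha => ?_, ?_⟩, ⟨fun b hb => ?_, ?_⟩, ?_⟩
  · exact h.nonneg _ (isPositiveMonomial_left (Q := Q) ha)
  · simpa [h.map_zero, α] using h.unit_left 0
  · exact h.nonneg _ (isPositiveMonomial_right (P := P) hb)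
  · simpa [h.map_zero, β] using h.unit_right 0
  · funext z
    induction z using monomial_induction with
    | zero => simp [h.map_zero, prodMoment]
    | left a z ih =>
      rw [map_left_of_mem_extremePoints hP hΛ, ih]
      simp [prodMoment, α, mul_assoc]
    | right b z ih =>
      rw [map_right_of_mem_extremePoints hQ hΛ, ih]
      simp [prodMoment, β, mul_left_comm]

/-- A closed convex set of functionals that contains the products of states contains all
moment functionals. -/
theorem IsMomentFunctional.mem_of_isClosed_of_convex (hP : IsOrderUnitCone P u)
    (hQ : IsOrderUnitCone Q v) (h : IsMomentFunctional P u Q v Λ)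
    {S : Set (Multiset A × Multiset B → ℝ)} (hS : IsClosed S) (hS' : Convex ℝ S)
    (hprod : ∀ α β, IsState P u α → IsState Q v β → prodMoment α β ∈ S) : Λ ∈ S := by
  have hmem : Λ ∈ closure (convexHull ℝ
      (Set.extremePoints ℝ {Λ | IsMomentFunctional P u Q v Λ})) := by
    rw [closure_convexHull_extremePoints (isCompact_setOf_isMomentFunctional hP hQ)
      convex_setOf_isMomentFunctional]
    exact h
  refine closure_minimal (convexHull_min ?_ hS') hS hmem
  intro Λ' hΛ'
  obtain ⟨α, β, hα, hβ, rfl⟩ := exists_eq_prodMoment_of_mem_extremePoints hP hQ hΛ'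
  exact hprod α β hα hβ

end

/-! ### Product functionals on tensor powers, and families as multisets. -/

section
variable {E : Type*} [AddCommGroup E] [Module ℝ E] {K : Set E}

/-- The last slot is enough, because symmetry of `y n` allows any factor of a monomial to be placed
there. -/
theorem prodFunctional_add_of_last {n : ℕ} (f f₁ f₂ : Fin (n + 1) → affFun K)
    (h₁ : ∀ i : Fin n, f₁ i.castSucc = f i.castSucc) (h₂ : ∀ i : Fin n, f₂ i.castSucc = f i.castSucc)
    (h : f (Fin.last n) = f₁ (Fin.last n) + f₂ (Fin.last n)) :
    prodFunctional K f = prodFunctional K f₁ + prodFunctional K f₂ := by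
  refine PiTensorProduct.ext (MultilinearMap.ext fun v => ?_)
  simp [prodFunctional_tprod, Fin.prod_univ_castSucc, h₁, h₂, h, mul_add]

theorem prodFunctional_smul_of_last {n : ℕ} (c : ℝ) (f f₁ : Fin (n + 1) → affFun K)
    (h₁ : ∀ i : Fin n, f₁ i.castSucc = f i.castSucc)
    (h : f (Fin.last n) = c • f₁ (Fin.last n)) :
    prodFunctional K f = c • prodFunctional K f₁ := by
  refine PiTensorProduct.ext (MultilinearMap.ext fun v => ?_)
  simp [prodFunctional_tprod, Fin.prod_univ_castSucc, h₁, h, mul_left_comm]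

theorem prodFunctional_comp_partialTrace {n : ℕ} (f : Fin (n + 1) → affFun K)
    (h : f (Fin.last n) = unitFun K) :
    prodFunctional K (fun i : Fin n => f i.castSucc) ∘ₗ partialTrace K n = prodFunctional K f := by
  refine PiTensorProduct.ext (MultilinearMap.ext fun v => ?_)
  simp [prodFunctional_tprod, partialTrace_tprod, Fin.prod_univ_castSucc, h, mul_comm]

theorem prodFunctional_comp_permFactors {n : ℕ} (f : Fin n → affFun K)
    (σ : Equiv.Perm (Fin n)) :
    prodFunctional K f ∘ₗ permFactors K σ = prodFunctional K (f ∘ σ) := by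
  refine PiTensorProduct.ext (MultilinearMap.ext fun v => ?_)
  simp only [LinearMap.compMultilinearMap_apply, LinearMap.comp_apply, permFactors,
    LinearEquiv.coe_coe, PiTensorProduct.reindex_tprod, prodFunctional_tprod]
  exact Fintype.prod_equiv σ.symm _ _ fun i => by simp

theorem stateEmb_apply (x : K) (f : affFun K) : stateEmb K x f = (f : K → ℝ) x := rfl

/-- Two families with the same multiset of values differ by a permutation. -/
theorem exists_perm_of_map_univ_eq {ι α : Type*} [Fintype ι] (f g : ι → α)
    (h : Finset.univ.val.map f = Finset.univ.val.map g) :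
    ∃ σ : Equiv.Perm ι, f = g ∘ σ := by
  classical
  have hc : ∀ a, Fintype.card {i // f i = a} = Fintype.card {i // g i = a} := by
    intro a
    have := congrArg (Multiset.count a) h
    rw [Multiset.count_map, Multiset.count_map] at this
    rw [Fintype.card_subtype, Fintype.card_subtype]
    simp only [eq_comm (a := a)] at this
    exact this
  refine ⟨Equiv.ofFiberEquiv (f := f) (g := g) fun a => Fintype.equivOfCardEq (hc a), ?_⟩
  funext i
  exact (Equiv.ofFiberEquiv_map _ _).symm

theorem exists_map_univ_eq {α : Type*} {n : ℕ} (s : Multiset α) (hs : s.card = n) :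
    ∃ f : Fin n → α, Finset.univ.val.map f = s := by
  obtain ⟨l, rfl⟩ : ∃ l : List α, (l : Multiset α) = s := ⟨s.toList, s.coe_toList⟩
  rw [Multiset.coe_card] at hs
  subst hs
  exact ⟨l.get, by simp [Fin.univ_val_map]⟩
end

/-! ### Affine functions on a convex set and their states. -/

section
variable {E : Type*} [AddCommGroup E] [Module ℝ E] {K : Set E}

/-- The restriction to `K` of the affine function `x ↦ ℓ x + c`. -/
def affRestrict (K : Set E) : (Module.Dual ℝ E × ℝ) →ₗ[ℝ] affFun K where
  toFun p := ⟨fun x => p.1 x + p.2, by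
    intro x y z a b _ _ hab h
    simp only [h, map_add, map_smul, smul_eq_mul]
    linear_combination -p.2 * hab⟩
  map_add' p q := by
    ext x
    simp only [Prod.fst_add, Prod.snd_add, LinearMap.add_apply, Submodule.coe_add, Pi.add_apply]
    ring
  map_smul' c p := by
    ext x
    simp [mul_add]

theorem affRestrict_apply (p : Module.Dual ℝ E × ℝ) (x : K) :
    (affRestrict K p : K → ℝ) x = p.1 x + p.2 := rfl

/-- An affine function is both convex and concave, so Jensen's inequality holds in both directions.
The extension by zero only serves to have a function on all of `E`. -/
theorem affFun_sum_centerMass (hK : Convex ℝ K) (f : affFun K) (t : Finset K) (w : K → ℝ)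
    (hw : ∀ x ∈ t, 0 ≤ w x) (hpos : 0 < ∑ x ∈ t, w x) :
    Function.extend Subtype.val (f : K → ℝ) 0 (t.centerMass w Subtype.val) =
      t.centerMass w (f : K → ℝ) := by
  have hF : ∀ x : K, Function.extend Subtype.val (f : K → ℝ) 0 (x : E) = (f : K → ℝ) x :=
    fun x => Subtype.val_injective.extend_apply _ _ _
  have hmid : ∀ ⦃x⦄, x ∈ K → ∀ ⦃y⦄, y ∈ K → ∀ ⦃a b : ℝ⦄, 0 ≤ a → 0 ≤ b → a + b = 1 →
      Function.extend Subtype.val (f : K → ℝ) 0 (a • x + b • y) =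
        a • Function.extend Subtype.val (f : K → ℝ) 0 x +
          b • Function.extend Subtype.val (f : K → ℝ) 0 y := by
    intro x hx y hy a b ha hb hab
    have := f.2 ⟨x, hx⟩ ⟨y, hy⟩ ⟨_, hK hx hy ha hb hab⟩ a b ha hb hab rfl
    simpa only [← hF, smul_eq_mul] using this
  have hconv : ConvexOn ℝ K (Function.extend Subtype.val (f : K → ℝ) 0) :=
    ⟨hK, fun x hx y hy a b ha hb hab => (hmid hx hy ha hb hab).le⟩
  have hconc : ConcaveOn ℝ K (Function.extend Subtype.val (f : K → ℝ) 0) :=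
    ⟨hK, fun x hx y hy a b ha hb hab => (hmid hx hy ha hb hab).ge⟩
  have h1 := hconv.map_centerMass_le (p := Subtype.val) hw hpos fun x _ => x.2
  have h2 := hconc.le_map_centerMass (p := Subtype.val) hw hpos fun x _ => x.2
  have h3 : Function.extend Subtype.val (f : K → ℝ) 0 ∘ Subtype.val = (f : K → ℝ) :=
    funext hF
  rw [h3] at h1 h2
  exact le_antisymm h1 h2

/-- An affine function annihilates the affine dependencies of its arguments. -/
theorem affFun_linearCombination_eq_zero (hK : Convex ℝ K) (f : affFun K) (c : K →₀ ℝ)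
    (hc : Finsupp.linearCombination ℝ (fun x : K => ((x : E), (1 : ℝ))) c = 0) :
    Finsupp.linearCombination ℝ (f : K → ℝ) c = 0 := by
  rw [Finsupp.linearCombination_apply, Finsupp.sum] at hc ⊢
  have hc1 : ∑ x ∈ c.support, c x • (x : E) = 0 := by
    simpa [Prod.fst_sum] using congrArg Prod.fst hc
  have hc2 : ∑ x ∈ c.support, c x = 0 := by
    simpa [Prod.snd_sum] using congrArg Prod.snd hc
  -- The positive and negative parts of `c` have the same total mass and the same weighted sum of
  -- points, hence the same centre of mass unless both vanish.
  have hsplit : ∀ x, c x = max (c x) 0 - max (-c x) 0 := fun x =>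
    (max_zero_sub_max_neg_zero_eq_self _).symm
  have hs : ∑ x ∈ c.support, max (c x) 0 = ∑ x ∈ c.support, max (-c x) 0 := by
    rw [← sub_eq_zero, ← Finset.sum_sub_distrib]
    simpa only [← hsplit] using hc2
  have hv : ∑ x ∈ c.support, max (c x) 0 • (x : E) = ∑ x ∈ c.support, max (-c x) 0 • (x : E) := by
    rw [← sub_eq_zero, ← Finset.sum_sub_distrib]
    simpa only [← sub_smul, ← hsplit] using hc1
  have hnn : 0 ≤ ∑ x ∈ c.support, max (c x) 0 := Finset.sum_nonneg fun x _ => le_max_right _ _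
  rcases hnn.eq_or_lt with h0 | hpos
  · have h1 := (Finset.sum_eq_zero_iff_of_nonneg fun x _ => le_max_right _ _).1 h0.symm
    have h2 := (Finset.sum_eq_zero_iff_of_nonneg fun x _ => le_max_right _ _).1 (hs ▸ h0.symm)
    refine Finset.sum_eq_zero fun x hx => ?_
    rw [hsplit x, h1 x hx, h2 x hx]
    simp
  · have e1 := affFun_sum_centerMass hK f c.support (fun x => max (c x) 0)
      (fun x _ => le_max_right _ _) hpos
    have e2 := affFun_sum_centerMass hK f c.support (fun x => max (-c x) 0)
      (fun x _ => le_max_right _ _) (hs ▸ hpos)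
    simp only [Finset.centerMass] at e1 e2
    rw [hs, hv, e2] at e1
    have e3 := smul_right_injective ℝ (inv_ne_zero (hs ▸ hpos.ne')) e1
    simp only [smul_eq_mul] at e3 ⊢
    rw [Finset.sum_congr rfl fun x _ => by rw [hsplit x, sub_mul], Finset.sum_sub_distrib, e3,
      sub_self]

/-- Affine functions on a convex set extend to the whole space. -/
theorem affRestrict_surjective (hK : Convex ℝ K) : Function.Surjective (affRestrict K) := by
  intro f
  set lc := Finsupp.linearCombination ℝ (fun x : K => ((x : E), (1 : ℝ))) with hlc
  -- The linear extension of `f` to the free vector space on `K` vanishes on the kernel of `lc`, so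
  -- it factors through `E × ℝ`.
  have hmem : (Finsupp.linearCombination ℝ (f : K → ℝ) : Module.Dual ℝ (K →₀ ℝ)) ∈
      LinearMap.range lc.dualMap := by
    rw [LinearMap.range_dualMap_eq_dualAnnihilator_ker, Submodule.mem_dualAnnihilator]
    exact fun c hc => affFun_linearCombination_eq_zero hK f c (LinearMap.mem_ker.1 hc)
  obtain ⟨h, hh⟩ := hmem
  refine ⟨(h ∘ₗ LinearMap.inl ℝ E ℝ, h (0, 1)), ?_⟩
  ext x
  have hx := LinearMap.congr_fun hh (Finsupp.single x 1)
  simp only [LinearMap.dualMap_apply, hlc, Finsupp.linearCombination_single, one_smul] at hx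
  rw [affRestrict_apply, ← hx]
  simp [← map_add]

end

section
variable {E : Type*} [NormedAddCommGroup E] [NormedSpace ℝ E] [FiniteDimensional ℝ E] {K : Set E}

theorem finite_affFun (hK : Convex ℝ K) : Module.Finite ℝ (affFun K) :=
  Module.Finite.of_surjective (affRestrict K) (affRestrict_surjective hK)

theorem continuous_affFun (hK : Convex ℝ K) (f : affFun K) : Continuous (f : K → ℝ) := by
  obtain ⟨p, rfl⟩ := affRestrict_surjective hK f
  exact ((p.1.continuous_of_finiteDimensional).comp continuous_subtype_val).add continuous_const

theorem isOrderUnitCone_affPos (hK : IsCompact K) (hK' : Convex ℝ K) :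
    IsOrderUnitCone (affPos K) (unitFun K) where
  add_mem f g hf hg x := add_nonneg (hf x) (hg x)
  exists_bound f := by
    have := isCompact_iff_compactSpace.1 hK
    obtain ⟨c, hc⟩ := isCompact_univ.exists_bound_of_continuousOn
      (continuous_affFun hK' f).continuousOn
    -- The bound `c` may fail to be positive; `|c| + 1` is.
    have hb : ∀ x : K, |(f : K → ℝ) x| ≤ |c| + 1 := fun x => by
      have := hc x trivial
      rw [Real.norm_eq_abs] at this
      linarith [le_abs_self c]
    refine ⟨|c| + 1, by positivity, fun x => ?_, fun x => ?_⟩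
    · have := (abs_le.1 (hb x)).1
      simp only [Submodule.coe_add, Submodule.coe_smul, Pi.add_apply, Pi.smul_apply, unitFun,
        smul_eq_mul]
      linarith
    · have := (abs_le.1 (hb x)).2
      simp only [Submodule.coe_sub, Submodule.coe_smul, Pi.sub_apply, Pi.smul_apply, unitFun,
        smul_eq_mul]
      linarith

/-- States on `A(K)` are evaluations at points of `K`. -/
theorem IsState.exists_eq_stateEmb (hK : IsCompact K) (hK' : Convex ℝ K)
    {α : affFun K →ₗ[ℝ] ℝ} (hα : IsState (affPos K) (unitFun K) α) :
    ∃ x : K, α = stateEmb K x := by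
  have hunit : affRestrict K (0, 1) = unitFun K := by
    ext x
    simp [affRestrict_apply, unitFun]
  have hsplit : ∀ p : Module.Dual ℝ E × ℝ,
      α (affRestrict K p) = α (affRestrict K (p.1, 0)) + p.2 := by
    intro p
    have : p = (p.1, 0) + p.2 • ((0 : Module.Dual ℝ E), (1 : ℝ)) := by ext <;> simp
    conv_lhs => rw [this]
    rw [map_add, map_smul, hunit, map_add, map_smul, hα.unit]
    simp
  -- On linear functionals `α` is an element of the double dual, hence evaluation at some point of
  -- `E`.
  let ψ : Module.Dual ℝ (Module.Dual ℝ E) :=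
    α ∘ₗ affRestrict K ∘ₗ LinearMap.inl ℝ (Module.Dual ℝ E) ℝ
  obtain ⟨x, hx⟩ := (Module.evalEquiv ℝ E).surjective ψ
  have hx' : ∀ ℓ : Module.Dual ℝ E, α (affRestrict K (ℓ, 0)) = ℓ x := fun ℓ => by
    have := LinearMap.congr_fun hx ℓ
    simpa [ψ] using this.symm
  have hxK : x ∈ K := by
    by_contra hn
    obtain ⟨ℓ, c, h1, h2⟩ := geometric_hahn_banach_closed_point hK' hK.isClosed hn
    -- The separating function `c - ℓ` is nonnegative on `K`, but `α` takes the negative value `c -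
    -- ℓ x` on it.
    have h3 := hα.nonneg (affRestrict K (-(ℓ : E →ₗ[ℝ] ℝ), c)) fun y => by
      have := h1 y y.2
      simp only [affRestrict_apply, LinearMap.neg_apply, ContinuousLinearMap.coe_coe]
      linarith
    rw [hsplit, hx'] at h3
    simp only [LinearMap.neg_apply, ContinuousLinearMap.coe_coe] at h3
    linarith
  refine ⟨⟨x, hxK⟩, LinearMap.ext fun f => ?_⟩
  obtain ⟨p, rfl⟩ := affRestrict_surjective hK' f
  rw [hsplit, hx', stateEmb_apply, affRestrict_apply]

end

/-! ### The moment functional of a bicompatible sequence. -/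

section
variable {E F : Type*} [AddCommGroup E] [Module ℝ E] [AddCommGroup F] [Module ℝ F]
  {KA : Set E} {KB : Set F}

/-- The functional `f₁ ⊗ ⋯ ⊗ fₙ ⊗ g₁ ⊗ ⋯ ⊗ gₙ`. -/
def biFunctional {n : ℕ} (f : Fin n → affFun KA) (g : Fin n → affFun KB) :
    Module.Dual ℝ (DualAffPow KA n ⊗[ℝ] DualAffPow KB n) :=
  TensorProduct.dualDistrib ℝ _ _ (prodFunctional KA f ⊗ₜ[ℝ] prodFunctional KB g)

theorem biFunctional_tmul {n : ℕ} (f : Fin n → affFun KA) (g : Fin n → affFun KB)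
    (v : DualAffPow KA n) (w : DualAffPow KB n) :
    biFunctional f g (v ⊗ₜ[ℝ] w) = prodFunctional KA f v * prodFunctional KB g w := by
  simp [biFunctional]

theorem dualDistrib_comp_map {V V' W W' : Type*} [AddCommMonoid V] [Module ℝ V] [AddCommMonoid V']
    [Module ℝ V'] [AddCommMonoid W] [Module ℝ W] [AddCommMonoid W'] [Module ℝ W']
    (G : Module.Dual ℝ V') (H : Module.Dual ℝ W') (p : V →ₗ[ℝ] V') (q : W →ₗ[ℝ] W')
    (w : V ⊗[ℝ] W) :
    TensorProduct.dualDistrib ℝ V' W' (G ⊗ₜ[ℝ] H) (TensorProduct.map p q w) =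
      TensorProduct.dualDistrib ℝ V W ((G ∘ₗ p) ⊗ₜ[ℝ] (H ∘ₗ q)) w := by
  induction w using TensorProduct.induction_on with
  | zero => simp
  | tmul x y => simp
  | add x y hx hy => simp only [map_add, hx, hy]

/-- The function `x ↦ ∏ f(x_A) ∏ g(x_B)`. -/
def evalMoment (z : Multiset (affFun KA) × Multiset (affFun KB)) (x : KA × KB) : ℝ :=
  prodMoment (stateEmb KA x.1) (stateEmb KB x.2) z

theorem evalMoment_add (z w : Multiset (affFun KA) × Multiset (affFun KB)) (x : KA × KB) :
    evalMoment (z + w) x = evalMoment z x * evalMoment w x := by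
  simp only [evalMoment, prodMoment, Prod.fst_add, Prod.snd_add, Multiset.map_add,
    Multiset.prod_add]
  ring

theorem evalMoment_pad (s : Multiset (affFun KA)) (t : Multiset (affFun KB)) (k l : ℕ)
    (x : KA × KB) :
    evalMoment (s + Multiset.replicate k (unitFun KA), t + Multiset.replicate l (unitFun KB)) x =
      evalMoment (s, t) x := by
  have h1 : stateEmb KA x.1 (unitFun KA) = 1 := rfl
  have h2 : stateEmb KB x.2 (unitFun KB) = 1 := rfl
  simp [evalMoment, prodMoment, h1, h2]

theorem biFunctional_prodState {n : ℕ} (f : Fin n → affFun KA) (g : Fin n → affFun KB)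
    (x : KA × KB) :
    biFunctional f g (prodState KA KB n x) =
      evalMoment (Finset.univ.val.map f, Finset.univ.val.map g) x := by
  rw [prodState, biFunctional_tmul, prodFunctional_tprod, prodFunctional_tprod]
  simp only [evalMoment, prodMoment, Finset.prod, Multiset.map_map, Function.comp_def]

/-- `y n` has equally many factors of both kinds, while a monomial may have different degrees in
`A(K_A)` and `A(K_B)`. Padding each side with as many units as the other side has factors equalises
them. -/
theorem exists_padded (s : Multiset (affFun KA)) (t : Multiset (affFun KB)) :
    ∃ (f : Fin (s.card + t.card) → affFun KA) (g : Fin (s.card + t.card) → affFun KB),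
      Finset.univ.val.map f = s + Multiset.replicate t.card (unitFun KA) ∧
      Finset.univ.val.map g = t + Multiset.replicate s.card (unitFun KB) := by
  obtain ⟨f, hf⟩ := exists_map_univ_eq (n := s.card + t.card)
    (s + Multiset.replicate t.card (unitFun KA)) (by simp)
  obtain ⟨g, hg⟩ := exists_map_univ_eq (n := s.card + t.card)
    (t + Multiset.replicate s.card (unitFun KB)) (by simp [add_comm])
  exact ⟨f, g, hf, hg⟩

theorem map_univ_snoc {α : Type*} {n : ℕ} (f : Fin n → α) (a : α) :
    (Finset.univ : Finset (Fin (n + 1))).val.map (Fin.snoc (α := fun _ => α) f a) =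
      a ::ₘ Finset.univ.val.map f := by
  rw [Fin.univ_val_map, Fin.univ_val_map, List.ofFn_succ']
  simp [← Multiset.coe_add]
  rw [add_comm, Multiset.singleton_add, Multiset.cons_coe]

namespace IsBicompatible
variable {y : ∀ n : ℕ, DualAffPow KA n ⊗[ℝ] DualAffPow KB n}

/-- Independence of the two permutations in `symm` is essential: the two families are reordered
separately. -/
theorem biFunctional_congr (hy : IsBicompatible KA KB y) {n : ℕ} {f f' : Fin n → affFun KA}
    {g g' : Fin n → affFun KB} (hf : Finset.univ.val.map f = Finset.univ.val.map f')
    (hg : Finset.univ.val.map g = Finset.univ.val.map g') :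
    biFunctional f g (y n) = biFunctional f' g' (y n) := by
  obtain ⟨σ, rfl⟩ := exists_perm_of_map_univ_eq f f' hf
  obtain ⟨τ, rfl⟩ := exists_perm_of_map_univ_eq g g' hg
  conv_rhs => rw [hy.symm n σ τ]
  rw [biFunctional, biFunctional, dualDistrib_comp_map, prodFunctional_comp_permFactors,
    prodFunctional_comp_permFactors]

theorem biFunctional_snoc_unit (hy : IsBicompatible KA KB y) {n : ℕ} (f : Fin n → affFun KA)
    (g : Fin n → affFun KB) :
    biFunctional (Fin.snoc (α := fun _ => affFun KA) f (unitFun KA))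
      (Fin.snoc (α := fun _ => affFun KB) g (unitFun KB)) (y (n + 1)) =
      biFunctional f g (y n) := by
  conv_rhs => rw [hy.trace n]
  rw [biFunctional, biFunctional, dualDistrib_comp_map,
    ← prodFunctional_comp_partialTrace _ (by simp), ← prodFunctional_comp_partialTrace _ (by simp)]
  simp

theorem biFunctional_eq_of_pad (hy : IsBicompatible KA KB y) (j : ℕ) {n n' : ℕ} (h : n + j = n')
    {f : Fin n → affFun KA} {g : Fin n → affFun KB} {f' : Fin n' → affFun KA}
    {g' : Fin n' → affFun KB}
    (hf : Finset.univ.val.map f' = Finset.univ.val.map f + Multiset.replicate j (unitFun KA))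
    (hg : Finset.univ.val.map g' = Finset.univ.val.map g + Multiset.replicate j (unitFun KB)) :
    biFunctional f' g' (y n') = biFunctional f g (y n) := by
  induction j generalizing n with
  | zero =>
    obtain rfl : n = n' := h
    exact hy.biFunctional_congr (by simpa using hf) (by simpa using hg)
  | succ j ih =>
    rw [← hy.biFunctional_snoc_unit f g]
    refine ih (n := n + 1) (by omega) ?_ ?_
    · rw [hf, map_univ_snoc, Multiset.replicate_succ, Multiset.add_cons, Multiset.cons_add]
    · rw [hg, map_univ_snoc, Multiset.replicate_succ, Multiset.add_cons, Multiset.cons_add]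

/-- The moment functional of a bicompatible sequence. -/
def moment (y : ∀ n : ℕ, DualAffPow KA n ⊗[ℝ] DualAffPow KB n)
    (z : Multiset (affFun KA) × Multiset (affFun KB)) : ℝ :=
  biFunctional (exists_padded z.1 z.2).choose (exists_padded z.1 z.2).choose_spec.choose
    (y (z.1.card + z.2.card))

/-- Makes `moment` independent of the choices in its definition: of two padded representations, the
longer arises from the shorter by adding equally many units on both sides, up to reordering. -/
theorem moment_eq (hy : IsBicompatible KA KB y) {n k l : ℕ} {f : Fin n → affFun KA}
    {g : Fin n → affFun KB} {s : Multiset (affFun KA)} {t : Multiset (affFun KB)}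
    (hf : Finset.univ.val.map f = s + Multiset.replicate k (unitFun KA))
    (hg : Finset.univ.val.map g = t + Multiset.replicate l (unitFun KB)) :
    moment y (s, t) = biFunctional f g (y n) := by
  obtain ⟨hf', hg'⟩ := (exists_padded s t).choose_spec.choose_spec
  have h1 : n = s.card + k := by simpa using congrArg Multiset.card hf
  have h2 : n = t.card + l := by simpa using congrArg Multiset.card hg
  rcases le_total n (s.card + t.card) with h | h
  · obtain ⟨j, hj⟩ := Nat.exists_eq_add_of_le h
    refine hy.biFunctional_eq_of_pad j hj.symm ?_ ?_
    · rw [hf', hf, add_assoc, ← Multiset.replicate_add]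
      congr 2; omega
    · rw [hg', hg, add_assoc, ← Multiset.replicate_add]
      congr 2; omega
  · obtain ⟨j, hj⟩ := Nat.exists_eq_add_of_le h
    refine (hy.biFunctional_eq_of_pad j hj.symm ?_ ?_).symm
    · rw [hf', hf, add_assoc, ← Multiset.replicate_add]
      congr 2; omega
    · rw [hg', hg, add_assoc, ← Multiset.replicate_add]
      congr 2; omega

/-- The new factor goes into the last slot, where linearity is available; a unit on the other side
keeps the lengths equal. -/
theorem moment_left (hy : IsBicompatible KA KB y) {n k l : ℕ} {f : Fin n → affFun KA}
    {g : Fin n → affFun KB} {z : Multiset (affFun KA) × Multiset (affFun KB)}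
    (hf : Finset.univ.val.map f = z.1 + Multiset.replicate k (unitFun KA))
    (hg : Finset.univ.val.map g = z.2 + Multiset.replicate l (unitFun KB)) (a : affFun KA) :
    moment y (({a}, 0) + z) = biFunctional (Fin.snoc (α := fun _ => affFun KA) f a)
      (Fin.snoc (α := fun _ => affFun KB) g (unitFun KB)) (y (n + 1)) := by
  rw [show (({a}, 0) + z : Multiset (affFun KA) × Multiset (affFun KB)) =
    ({a} + z.1, 0 + z.2) from Prod.ext rfl rfl]
  refine hy.moment_eq (k := k) (l := l + 1) ?_ ?_
  · rw [map_univ_snoc, hf, add_assoc, Multiset.singleton_add]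
  · rw [map_univ_snoc, hg, Multiset.replicate_succ, Multiset.add_cons, zero_add]

theorem moment_right (hy : IsBicompatible KA KB y) {n k l : ℕ} {f : Fin n → affFun KA}
    {g : Fin n → affFun KB} {z : Multiset (affFun KA) × Multiset (affFun KB)}
    (hf : Finset.univ.val.map f = z.1 + Multiset.replicate k (unitFun KA))
    (hg : Finset.univ.val.map g = z.2 + Multiset.replicate l (unitFun KB)) (b : affFun KB) :
    moment y ((0, {b}) + z) =
      biFunctional (Fin.snoc (α := fun _ => affFun KA) f (unitFun KA))
        (Fin.snoc (α := fun _ => affFun KB) g b) (y (n + 1)) := by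
  rw [show ((0, {b}) + z : Multiset (affFun KA) × Multiset (affFun KB)) =
    (0 + z.1, {b} + z.2) from Prod.ext rfl rfl]
  refine hy.moment_eq (k := k + 1) (l := l) ?_ ?_
  · rw [map_univ_snoc, hf, Multiset.replicate_succ, Multiset.add_cons, zero_add]
  · rw [map_univ_snoc, hg, add_assoc, Multiset.singleton_add]

theorem isMomentFunctional (hy : IsBicompatible KA KB y) :
    IsMomentFunctional (affPos KA) (unitFun KA) (affPos KB) (unitFun KB) (moment y) where
  map_zero := by
    have h0 : (0 : Multiset (affFun KA) × Multiset (affFun KB)) = (0, 0) := rfl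
    rw [h0, hy.moment_eq (k := 0) (l := 0) (f := fun _ : Fin 0 => unitFun KA)
      (g := fun _ : Fin 0 => unitFun KB) (by simp) (by simp)]
    exact (hy.mem 0).2
  nonneg z hz := by
    obtain ⟨f, g, hf, hg⟩ := exists_padded z.1 z.2
    rw [← Prod.mk.eta (p := z), hy.moment_eq hf hg]
    have hfpos : ∀ i, f i ∈ affPos KA := fun i => by
      have hi : f i ∈ z.1 + Multiset.replicate z.2.card (unitFun KA) :=
        hf ▸ Multiset.mem_map_of_mem f (Finset.mem_univ_val i)
      rcases Multiset.mem_add.1 hi with hi | hi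
      · exact hz.1 _ hi
      · rw [Multiset.eq_of_mem_replicate hi]
        exact fun _ => zero_le_one
    have hgpos : ∀ i, g i ∈ affPos KB := fun i => by
      have hi : g i ∈ z.2 + Multiset.replicate z.1.card (unitFun KB) :=
        hg ▸ Multiset.mem_map_of_mem g (Finset.mem_univ_val i)
      rcases Multiset.mem_add.1 hi with hi | hi
      · exact hz.2 _ hi
      · rw [Multiset.eq_of_mem_replicate hi]
        exact fun _ => zero_le_one
    -- Products of nonnegative functions are nonnegative on the maximal tensor powers by definition,
    -- so they are admissible test functionals for `maxTensor`.
    exact (hy.mem _).1 _ _ (fun s hs => hs.1 f hfpos) (fun t ht => ht.1 g hgpos)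
  add_left a a' z := by
    obtain ⟨f, g, hf, hg⟩ := exists_padded z.1 z.2
    rw [hy.moment_left hf hg, hy.moment_left hf hg, hy.moment_left hf hg]
    simp only [biFunctional]
    rw [prodFunctional_add_of_last (Fin.snoc (α := fun _ => affFun KA) f (a + a'))
      (Fin.snoc (α := fun _ => affFun KA) f a) (Fin.snoc (α := fun _ => affFun KA) f a')
      (by simp) (by simp) (by simp), TensorProduct.add_tmul, map_add, LinearMap.add_apply]
  smul_left c a z := by
    obtain ⟨f, g, hf, hg⟩ := exists_padded z.1 z.2
    rw [hy.moment_left hf hg, hy.moment_left hf hg]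
    simp only [biFunctional]
    rw [prodFunctional_smul_of_last c (Fin.snoc (α := fun _ => affFun KA) f (c • a))
      (Fin.snoc (α := fun _ => affFun KA) f a) (by simp) (by simp), ← TensorProduct.smul_tmul',
      map_smul, LinearMap.smul_apply, smul_eq_mul]
  unit_left z := by
    obtain ⟨f, g, hf, hg⟩ := exists_padded z.1 z.2
    rw [hy.moment_left hf hg, hy.biFunctional_snoc_unit, ← hy.moment_eq hf hg]
  add_right b b' z := by
    obtain ⟨f, g, hf, hg⟩ := exists_padded z.1 z.2
    rw [hy.moment_right hf hg, hy.moment_right hf hg, hy.moment_right hf hg]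
    simp only [biFunctional]
    rw [prodFunctional_add_of_last (Fin.snoc (α := fun _ => affFun KB) g (b + b'))
      (Fin.snoc (α := fun _ => affFun KB) g b) (Fin.snoc (α := fun _ => affFun KB) g b')
      (by simp) (by simp) (by simp), TensorProduct.tmul_add, map_add, LinearMap.add_apply]
  smul_right c b z := by
    obtain ⟨f, g, hf, hg⟩ := exists_padded z.1 z.2
    rw [hy.moment_right hf hg, hy.moment_right hf hg]
    simp only [biFunctional]
    rw [prodFunctional_smul_of_last c (Fin.snoc (α := fun _ => affFun KB) g (c • b))
      (Fin.snoc (α := fun _ => affFun KB) g b) (by simp) (by simp), TensorProduct.tmul_smul,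
      map_smul, LinearMap.smul_apply, smul_eq_mul]
  unit_right z := by
    obtain ⟨f, g, hf, hg⟩ := exists_padded z.1 z.2
    rw [hy.moment_right hf hg, hy.biFunctional_snoc_unit, ← hy.moment_eq hf hg]

end IsBicompatible

/-- For the tensor basis built from the dual bases of `bA` and `bB`, the coordinate functionals are
the products of elements of `bA` and `bB`. -/
theorem exists_basis_coord_eq_biFunctional {ι κ : Type*} [Finite ι] [Finite κ]
    (bA : Module.Basis ι ℝ (affFun KA)) (bB : Module.Basis κ ℝ (affFun KB)) (n : ℕ) :
    ∃ b : Module.Basis ((Fin n → ι) × (Fin n → κ)) ℝ (DualAffPow KA n ⊗[ℝ] DualAffPow KB n),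
      ∀ p w, b.repr w p = biFunctional (fun i => bA (p.1 i)) (fun i => bB (p.2 i)) w := by
  classical
  refine ⟨(Basis.piTensorProduct fun _ : Fin n => bA.dualBasis).tensorProduct
    (Basis.piTensorProduct fun _ : Fin n => bB.dualBasis), ?_⟩
  rintro ⟨p, q⟩ w
  rw [← Module.Basis.coord_apply]
  revert w
  refine LinearMap.congr_fun ?_
  refine TensorProduct.ext (PiTensorProduct.ext (MultilinearMap.ext fun v =>
    PiTensorProduct.ext (MultilinearMap.ext fun w => ?_)))
  simp [biFunctional_tmul, prodFunctional_tprod]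
  rw [mul_comm]

/-- Functionals on `(A(K_A)^*)^{⊗ n} ⊗ (A(K_B)^*)^{⊗ n}` are combinations of product
functionals. -/
theorem exists_dual_eq_sum_biFunctional [Module.Finite ℝ (affFun KA)]
    [Module.Finite ℝ (affFun KB)] {n : ℕ}
    (L : Module.Dual ℝ (DualAffPow KA n ⊗[ℝ] DualAffPow KB n)) :
    ∃ (ι : Type) (_ : Fintype ι) (c : ι → ℝ) (f : ι → Fin n → affFun KA)
      (g : ι → Fin n → affFun KB), ∀ w, L w = ∑ i, c i * biFunctional (f i) (g i) w := by
  let bA := Module.finBasis ℝ (affFun KA)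
  let bB := Module.finBasis ℝ (affFun KB)
  obtain ⟨b, hb⟩ := exists_basis_coord_eq_biFunctional bA bB n
  refine ⟨_, inferInstance, fun p => L (b p), fun p i => bA (p.1 i), fun p i => bB (p.2 i),
    fun w => ?_⟩
  conv_lhs => rw [← b.sum_repr w]
  rw [map_sum]
  refine Finset.sum_congr rfl fun p _ => ?_
  rw [map_smul, hb, smul_eq_mul, mul_comm]

end

/-! ### Representing measures: existence and uniqueness. -/

section
variable {E F : Type*}
    [NormedAddCommGroup E] [NormedSpace ℝ E] [FiniteDimensional ℝ E]
    [NormedAddCommGroup F] [NormedSpace ℝ F] [FiniteDimensional ℝ F]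
    {KA : Set E} {KB : Set F}

theorem continuous_evalMoment (hKA' : Convex ℝ KA) (hKB' : Convex ℝ KB)
    (z : Multiset (affFun KA) × Multiset (affFun KB)) :
    Continuous (evalMoment z : KA × KB → ℝ) := by
  refine Continuous.mul ?_ ?_
  · exact continuous_multiset_prod z.1 fun f _ =>
      (continuous_affFun hKA' f).comp continuous_fst
  · exact continuous_multiset_prod z.2 fun g _ =>
      (continuous_affFun hKB' g).comp continuous_snd

/-- `evalMoment z` as a bounded continuous function. -/
def evalMomentBCF [CompactSpace KA] [CompactSpace KB] (hKA' : Convex ℝ KA) (hKB' : Convex ℝ KB)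
    (z : Multiset (affFun KA) × Multiset (affFun KB)) :
    BoundedContinuousFunction (KA × KB) ℝ :=
  BoundedContinuousFunction.mkOfCompact ⟨evalMoment z, continuous_evalMoment hKA' hKB' z⟩

variable [MeasurableSpace E] [BorelSpace E] [MeasurableSpace F] [BorelSpace F]

/-- Every moment functional is given by a probability measure. -/
theorem IsMomentFunctional.exists_measure (hKA : IsCompact KA) (hKA' : Convex ℝ KA)
    (hKB : IsCompact KB) (hKB' : Convex ℝ KB)
    {Λ : Multiset (affFun KA) × Multiset (affFun KB) → ℝ}
    (h : IsMomentFunctional (affPos KA) (unitFun KA) (affPos KB) (unitFun KB) Λ) :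
    ∃ μ : ProbabilityMeasure (KA × KB), ∀ z, Λ z = ∫ x, evalMoment z x ∂(μ : Measure _) := by
  have := isCompact_iff_compactSpace.1 hKA
  have := isCompact_iff_compactSpace.1 hKB
  let Φ : ProbabilityMeasure (KA × KB) → Multiset (affFun KA) × Multiset (affFun KB) → ℝ :=
    fun μ z => ∫ x, evalMoment z x ∂(μ : Measure (KA × KB))
  have hint : ∀ z (μ : ProbabilityMeasure (KA × KB)),
      Integrable (evalMoment z) (μ : Measure (KA × KB)) := fun z μ =>
    (evalMomentBCF hKA' hKB' z).integrable _
  have hΦ : Continuous Φ := continuous_pi fun z =>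
    ProbabilityMeasure.continuous_integral_boundedContinuousFunction (evalMomentBCF hKA' hKB' z)
  have hconv : Convex ℝ (Set.range Φ) := by
    rintro _ ⟨μ, rfl⟩ _ ⟨ν, rfl⟩ a b ha hb hab
    have hprob : IsProbabilityMeasure
        (ENNReal.ofReal a • (μ : Measure (KA × KB)) + ENNReal.ofReal b • (ν : Measure _)) :=
      ⟨by simp [← ENNReal.ofReal_add ha hb, hab]⟩
    refine ⟨⟨_, hprob⟩, funext fun z => ?_⟩
    simp only [Φ, ProbabilityMeasure.coe_mk, Pi.add_apply, Pi.smul_apply]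
    rw [integral_add_measure ((hint z μ).smul_measure ENNReal.ofReal_ne_top)
      ((hint z ν).smul_measure ENNReal.ofReal_ne_top), integral_smul_measure,
      integral_smul_measure, ENNReal.toReal_ofReal ha, ENNReal.toReal_ofReal hb]
  -- The probability measures on the compact space `KA × KB` form a weakly compact space, so the
  -- range of `Φ` is closed; Dirac measures supply the products of states.
  obtain ⟨μ, hμ⟩ := h.mem_of_isClosed_of_convex (isOrderUnitCone_affPos hKA hKA')
    (isOrderUnitCone_affPos hKB hKB') (isCompact_range hΦ).isClosed hconv fun α β hα hβ => by
      obtain ⟨x, rfl⟩ := hα.exists_eq_stateEmb hKA hKA'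
      obtain ⟨x', rfl⟩ := hβ.exists_eq_stateEmb hKB hKB'
      refine ⟨⟨Measure.dirac (x, x'), inferInstance⟩, funext fun z => ?_⟩
      simp only [Φ, ProbabilityMeasure.coe_mk]
      rw [integral_dirac]
      rfl
  exact ⟨μ, fun z => (congrFun hμ z).symm⟩

/-- Affine functions on a subset of a finite-dimensional space separate its points. -/
theorem exists_affFun_ne {V : Type*} [AddCommGroup V] [Module ℝ V] {K : Set V} {x y : K}
    (h : x ≠ y) : ∃ f : affFun K, (f : K → ℝ) x ≠ (f : K → ℝ) y := by
  have h' : (x : V) - y ≠ 0 := sub_ne_zero.2 fun hn => h (Subtype.ext hn)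
  obtain ⟨ℓ, hℓ⟩ : ∃ ℓ : Module.Dual ℝ V, ℓ ((x : V) - y) ≠ 0 := by
    by_contra! hn
    exact h' ((Module.forall_dual_apply_eq_zero_iff ℝ _).1 hn)
  refine ⟨affRestrict K (ℓ, 0), fun hn => hℓ ?_⟩
  simp only [affRestrict_apply, add_zero] at hn
  rw [map_sub, hn, sub_self]

/-- A probability measure on `K_A × K_B` is determined by its moments. -/
theorem measure_eq_of_integral_evalMoment_eq (hKA : IsCompact KA) (hKA' : Convex ℝ KA)
    (hKB : IsCompact KB) (hKB' : Convex ℝ KB) {μ ν : ProbabilityMeasure (KA × KB)}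
    (h : ∀ z, ∫ x, evalMoment z x ∂(μ : Measure (KA × KB)) =
      ∫ x, evalMoment z x ∂(ν : Measure (KA × KB))) : μ = ν := by
  have := isCompact_iff_compactSpace.1 hKA
  have := isCompact_iff_compactSpace.1 hKB
  let M : Submonoid (BoundedContinuousFunction (KA × KB) ℝ) :=
    { carrier := Set.range (evalMomentBCF hKA' hKB')
      one_mem' := ⟨0, by
        ext x
        simp [evalMomentBCF, evalMoment, prodMoment]⟩
      mul_mem' := by
        rintro _ _ ⟨z, rfl⟩ ⟨w, rfl⟩
        exact ⟨z + w, by ext x; exact evalMoment_add z w x⟩ }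
  let S : StarSubalgebra ℝ (BoundedContinuousFunction (KA × KB) ℝ) :=
    { Algebra.adjoin ℝ (M : Set (BoundedContinuousFunction (KA × KB) ℝ)) with
      star_mem' := fun {f} hf => by
        have : star f = f := by ext x; simp
        rwa [this] }
  have hmem : ∀ z, evalMomentBCF hKA' hKB' z ∈ S := fun z => Algebra.subset_adjoin ⟨z, rfl⟩
  refine Subtype.ext (ext_of_forall_mem_subalgebra_integral_eq_of_pseudoEMetric_complete_countable
    (𝕜 := ℝ) (P := (μ : Measure (KA × KB))) (P' := (ν : Measure (KA × KB))) (A := S) ?_ ?_)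
  · intro x y hxy
    obtain ⟨z, hz⟩ : ∃ z, evalMoment z x ≠ evalMoment z y := by
      by_cases h1 : x.1 = y.1
      · obtain ⟨g, hg⟩ := exists_affFun_ne fun h2 => hxy (Prod.ext h1 h2)
        exact ⟨(0, {g}), by simpa [evalMoment, prodMoment, stateEmb_apply] using hg⟩
      · obtain ⟨f, hf⟩ := exists_affFun_ne h1
        exact ⟨({f}, 0), by simpa [evalMoment, prodMoment, stateEmb_apply] using hf⟩
    exact ⟨_, ⟨_, ⟨_, hmem z, rfl⟩, rfl⟩, hz⟩
  · intro g hg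
    -- Monomials are closed under multiplication, so the algebra they generate is their linear span
    -- and linearity of the integral suffices.
    have hg' : g ∈ Submodule.span ℝ (M : Set (BoundedContinuousFunction (KA × KB) ℝ)) := by
      have h1 : g ∈ Subalgebra.toSubmodule
        (Algebra.adjoin ℝ (M : Set (BoundedContinuousFunction (KA × KB) ℝ))) := hg
      rwa [Algebra.adjoin_eq_span, Submonoid.closure_eq] at h1
    clear hg
    induction hg' using Submodule.span_induction with
    | mem g hg =>
      obtain ⟨z, rfl⟩ := hg
      exact h z
    | zero => simp
    | add f g _ _ hf hg =>
      simp only [BoundedContinuousFunction.coe_add, Pi.add_apply]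
      rw [integral_add (f.integrable _) (g.integrable _), hf, hg,
        integral_add (f.integrable _) (g.integrable _)]
    | smul c f _ hf =>
      simp only [BoundedContinuousFunction.coe_smul, smul_eq_mul]
      rw [integral_const_mul, hf, integral_const_mul]

end

end

theorem lemma1 {E F : Type*}
    [NormedAddCommGroup E] [NormedSpace ℝ E] [FiniteDimensional ℝ E]
    [MeasurableSpace E] [BorelSpace E]
    [NormedAddCommGroup F] [NormedSpace ℝ F] [FiniteDimensional ℝ F]
    [MeasurableSpace F] [BorelSpace F]
    (KA : Set E) (hKA : IsCompact KA) (hKA' : Convex ℝ KA)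
    (KB : Set F) (hKB : IsCompact KB) (hKB' : Convex ℝ KB)
    (y : ∀ n : ℕ, DualAffPow KA n ⊗[ℝ] DualAffPow KB n)
    (hy : IsBicompatible KA KB y) :
    ∃! μ : ProbabilityMeasure (KA × KB),
      ∀ n : ℕ, IsVectorIntegral (μ : Measure (KA × KB)) (prodState KA KB n) (y n) := by
  have := isCompact_iff_compactSpace.1 hKA
  have := isCompact_iff_compactSpace.1 hKB
  have := finite_affFun hKA'
  have := finite_affFun hKB'
  obtain ⟨μ, hμ⟩ := hy.isMomentFunctional.exists_measure hKA hKA' hKB hKB'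
  refine ⟨μ, fun n L => ?_, fun ν hν => ?_⟩
  -- Vector integrals need only be tested on product functionals, where both sides are moments of
  -- `μ`.
  · obtain ⟨ι, _, c, f, g, hL⟩ := exists_dual_eq_sum_biFunctional L
    have hint : ∀ i, Integrable (fun x => c i * biFunctional (f i) (g i) (prodState KA KB n x))
        (μ : Measure (KA × KB)) := fun i => by
      simp only [biFunctional_prodState]
      exact ((evalMomentBCF hKA' hKB' _).integrable _).const_mul _
    simp only [hL]
    refine ⟨integrable_finsetSum _ fun i _ => hint i, ?_⟩
    rw [integral_finsetSum _ fun i _ => hint i]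
    refine Finset.sum_congr rfl fun i _ => ?_
    rw [integral_const_mul]
    simp only [biFunctional_prodState]
    rw [← hμ, hy.moment_eq (k := 0) (l := 0) (f := f i) (g := g i) (by simp) (by simp)]
  · refine measure_eq_of_integral_evalMoment_eq hKA hKA' hKB hKB' fun z => ?_
    -- Conversely, each moment of `ν` is the pairing of one `y n` with a padded product functional;
    -- the units integrate as factors `1`.
    obtain ⟨f, g, hf, hg⟩ := exists_padded z.1 z.2
    rw [← hμ, ← Prod.mk.eta (p := z), hy.moment_eq hf hg, (hν _ (biFunctional f g)).2]
    simp only [biFunctional_prodState, hf, hg, evalMoment_pad]
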